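/- Let $\mathcal H$ be an infinite-dimensional separable complex Hilbert space and let $B(\mathcal H)$ be the algebra of bounded linear operators on $\mathcal H$. For $T\in B(\mathcal H)$ let $\mathcal N(T)$ and $\mathcal R(T)$ be the kernel and the range of $T$, and put $\alpha(T)=\dim\mathcal N(T)$ and $\beta(T)=\dim \mathcal H/\mathcal R(T)$, both in $\{0,1,2,\dots\}\cup\{\infty\}$. The operator $T$ is *semi-Fredholm* if $\mathcal R(T)$ is closed and $\alpha(T)<\infty$ or $\beta(T)<\infty$, and *Fredholm* if $\mathcal R(T)$ is closed and both are finite. The *index* of a semi-Fredholm operator is $i(T)=\alpha(T)-\beta(T)\in\mathbb Z\cup\{\pm\infty\}$. The operator $T$ is *upper semi-Weyl* if it is semi-Fredholm with $i(T)\le 0$. It is *Browder* if it is Fredholm and has finite ascent and descent, that is, $\mathcal N(T^n)=\mathcal N(T^{n+1})$ for some $n\ge 0$ and $\mathcal R(T^m)=\mathcal R(T^{m+1})$ for some $m\ge 0$. It is *bounded below* if there is $c>0$ with $\|Tx\|\ge c\|x\|$ for all $x$. It is *consistently invertible* if for every $S\in B(\mathcal H)$ the operators $TS$ and $ST$ are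 either both invertible or both non-invertible. Let $\sigma(T)$ be the spectrum of $T$ and $\mathrm{iso}\,\sigma(T)$ the set of its isolated points. Define $$\sigma_a(T)=\{\lambda\in\mathbb C: T-\lambda I\text{ is not bounded below}\},\qquad \sigma_{uw}(T)=\{\lambda\in\mathbb C: T-\lambda I\text{ is not upper semi-Weyl}\},$$ $$\sigma_b(T)=\{\lambda\in\mathbb C: T-\lambda I\text{ is not Browder}\},\qquad \sigma_{CI}(T)=\{\lambda\in\mathbb C: T-\lambda I\text{ is not consistently invertible}\},$$ $$E(T)=\{\lambda\in\mathrm{iso}\,\sigma(T):\alpha(T-\lambda I)>0\}.$$ Let $\sigma_{vv}(T)=\mathbb C\setminus\rho_{vv}(T)$, where $\rho_{vv}(T)$ is the set of all $\lambda\in\mathbb C$ for which there is $\epsilon>0$ such that, for every $\mu\in\mathbb C$ with $0<|\lambda-\mu|<\epsilon$, the operator $T-\mu I$ is upper semi-Weyl and $\mathcal N(T-\mu I)\subseteq\bigcap_{n=1}^\infty\mathcal R\big((T-\mu I)^n\big)$. The operator $T$ *satisfies property $(UW_E)$* if $\sigma_a(T)\setminus E(T)=\sigma_{uw}(T)$,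 and it is *isoloid* if every isolated point of $\sigma(T)$ is an eigenvalue of $T$. **Theorem.** Let $T\in B(\mathcal H)$ satisfy property $(UW_E)$, and let $K\in B(\mathcal H)$ be a finite rank operator with $KT=TK$. Then the following are equivalent: 1. $T+K$ is isoloid and satisfies property $(UW_E)$; 2. $T$ is isoloid and $T+K$ satisfies property $(UW_E)$; 3. $\sigma_b(T)\cap\sigma_a(T+K)=\sigma_{vv}(T)\cup\big[\overline{\sigma_{CI}(T)}\cap\sigma_a(T)\big]$. -/

import Mathlib

namespace ContinuousLinearMap

section Hilbert

variable {H : Type*} [NormedAddCommGroup H] [InnerProductSpace ℂ H]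

/-- The nullity `α(T)`: the dimension of the kernel of `T`, with value `⊤` if it is infinite. -/
noncomputable def nullity (T : H →L[ℂ] H) : ℕ∞ :=
  Cardinal.toENat (Module.rank ℂ T.ker)

/-- The defect `β(T)`: the codimension of the range of `T`, with value `⊤` if it is infinite. -/
noncomputable def defect (T : H →L[ℂ] H) : ℕ∞ :=
  Cardinal.toENat (Module.rank ℂ (H ⧸ T.range))

/-- Upper semi-Fredholm operators: finite nullity and closed range. -/
def IsUpperSemiFredholm (T : H →L[ℂ] H) : Prop :=
  T.nullity < ⊤ ∧ IsClosed (T.range : Set H)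

/-- Lower semi-Fredholm operators: finite defect and closed range. -/
def IsLowerSemiFredholm (T : H →L[ℂ] H) : Prop :=
  T.defect < ⊤ ∧ IsClosed (T.range : Set H)

/-- Semi-Fredholm operators. -/
def IsSemiFredholm (T : H →L[ℂ] H) : Prop :=
  T.IsUpperSemiFredholm ∨ T.IsLowerSemiFredholm

/-- The index `i(T) = α(T) - β(T)`, an extended integer. It is used only for semi-Fredholm
operators, for which `α(T)` and `β(T)` are not both infinite. -/
noncomputable def index (T : H →L[ℂ] H) : EReal :=
  ((T.nullity : ENNReal) : EReal) - ((T.defect : ENNReal) : EReal)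

/-- Upper semi-Weyl operators: semi-Fredholm of index at most `0`. -/
def IsUpperSemiWeyl (T : H →L[ℂ] H) : Prop :=
  T.IsSemiFredholm ∧ T.index ≤ 0

/-- The ascent `p(T)`: the least `n` with `N(Tⁿ) = N(Tⁿ⁺¹)`, and `⊤` if there is none. -/
noncomputable def ascent (T : H →L[ℂ] H) : ℕ∞ :=
  ⨅ (n : ℕ) (_ : (T ^ n).ker = (T ^ (n + 1)).ker), (n : ℕ∞)

/-- The descent `q(T)`: the least `n` with `R(Tⁿ) = R(Tⁿ⁺¹)`, and `⊤` if there is none. -/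
noncomputable def descent (T : H →L[ℂ] H) : ℕ∞ :=
  ⨅ (n : ℕ) (_ : (T ^ n).range = (T ^ (n + 1)).range), (n : ℕ∞)

/-- On a Hilbert space, Mathlib's Fredholm operators are the operators that are both upper and
lower semi-Fredholm. -/
theorem isFredholm_iff_upper_lower [CompleteSpace H] (T : H →L[ℂ] H) :
    T.IsFredholm ↔ T.IsUpperSemiFredholm ∧ T.IsLowerSemiFredholm := by
  have hker : T.nullity < ⊤ ↔ FiniteDimensional ℂ T.ker := by
    rw [nullity, Cardinal.toENat_lt_top, Module.rank_lt_aleph0_iff]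
  have hcoker : T.defect < ⊤ ↔ FiniteDimensional ℂ (H ⧸ T.range) := by
    rw [defect, Cardinal.toENat_lt_top, Module.rank_lt_aleph0_iff]
  constructor
  · intro h
    exact ⟨⟨hker.2 h.finite_ker, h.isClosed_range⟩, ⟨hcoker.2 h.finite_coker, h.isClosed_range⟩⟩
  · rintro ⟨⟨h1, h2⟩, ⟨h3, -⟩⟩
    have hfin := hker.1 h1
    have : CompleteSpace T.range := h2.completeSpace_coe
    refine ⟨?_, h2, hfin, hcoker.1 h3, Submodule.ClosedComplemented.of_finiteDimensional _⟩
    rw [Topology.isStrictMap_iff_isQuotientMap_rangeFactorization]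
    have hs : Function.Surjective (T.codRestrict T.range fun x => ⟨x, rfl⟩) := by
      rintro ⟨_, x, rfl⟩
      exact ⟨x, rfl⟩
    exact (T.codRestrict T.range fun x => ⟨x, rfl⟩).isQuotientMap hs

/-- Browder operators: Fredholm operators with finite ascent and finite descent. -/
def IsBrowder (T : H →L[ℂ] H) : Prop :=
  T.IsFredholm ∧ T.ascent < ⊤ ∧ T.descent < ⊤

/-- Operators that are bounded below. -/
def IsBoundedBelow (T : H →L[ℂ] H) : Prop :=
  ∃ c : ℝ, 0 < c ∧ ∀ x, c * ‖x‖ ≤ ‖T x‖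

/-- `T` is consistently invertible if, for every bounded operator `S`, the products `TS` and `ST`
are either both invertible or both non-invertible. -/
def IsConsistentlyInvertible (T : H →L[ℂ] H) : Prop :=
  ∀ S : H →L[ℂ] H, IsUnit (T * S) ↔ IsUnit (S * T)

/-- The approximate point spectrum `σ_a(T)`. -/
def approxPointSpectrum (T : H →L[ℂ] H) : Set ℂ :=
  {z | ¬ (T - z • (1 : H →L[ℂ] H)).IsBoundedBelow}

/-- The upper semi-Weyl spectrum `σ_uw(T)`. -/
def upperSemiWeylSpectrum (T : H →L[ℂ] H) : Set ℂ :=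
  {z | ¬ (T - z • (1 : H →L[ℂ] H)).IsUpperSemiWeyl}

/-- The Browder spectrum `σ_b(T)`. -/
def browderSpectrum (T : H →L[ℂ] H) : Set ℂ :=
  {z | ¬ (T - z • (1 : H →L[ℂ] H)).IsBrowder}

/-- The consistent invertibility spectrum `σ_CI(T)`. -/
def consistentInvertibilitySpectrum (T : H →L[ℂ] H) : Set ℂ :=
  {z | ¬ (T - z • (1 : H →L[ℂ] H)).IsConsistentlyInvertible}

/-- The set `ρ_vv(T)`: the points `z` with a punctured disc around them on which `T - μI` is upper
semi-Weyl and `N(T - μI)` is contained in the range of every power of `T - μI`. -/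
def rhoVV (T : H →L[ℂ] H) : Set ℂ :=
  {z | ∃ ε : ℝ, 0 < ε ∧ ∀ μ : ℂ, 0 < ‖z - μ‖ → ‖z - μ‖ < ε →
    (T - μ • (1 : H →L[ℂ] H)).IsUpperSemiWeyl ∧
      (T - μ • (1 : H →L[ℂ] H)).ker ≤
        ⨅ (n : ℕ) (_ : 1 ≤ n), ((T - μ • (1 : H →L[ℂ] H)) ^ n).range}

/-- The spectrum `σ_vv(T)`, the complement of `ρ_vv(T)`. -/
def sigmaVV (T : H →L[ℂ] H) : Set ℂ :=
  (T.rhoVV)ᶜ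

/-- The isolated points of the spectrum of `T`. -/
def isoSpectrum (T : H →L[ℂ] H) : Set ℂ :=
  {z | z ∈ spectrum ℂ T ∧ ∃ ε : ℝ, 0 < ε ∧ Metric.ball z ε ∩ spectrum ℂ T = {z}}

/-- The set `E(T)` of the isolated points `z` of the spectrum of `T` with `α(T - zI) > 0`. -/
def isolatedEigenvalues (T : H →L[ℂ] H) : Set ℂ :=
  {z | z ∈ T.isoSpectrum ∧ 0 < (T - z • (1 : H →L[ℂ] H)).nullity}

/-- Property `(UW_E)`: `σ_a(T) \ E(T) = σ_uw(T)`. -/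
def PropertyUWE (T : H →L[ℂ] H) : Prop :=
  T.approxPointSpectrum \ T.isolatedEigenvalues = T.upperSemiWeylSpectrum

/-- `T` is isoloid if every isolated point of its spectrum is an eigenvalue of `T`. -/
def IsIsoloid (T : H →L[ℂ] H) : Prop :=
  ∀ z ∈ T.isoSpectrum, Module.End.HasEigenvalue (T : Module.End ℂ H) z

end Hilbert

end ContinuousLinearMap

/-! Write, at a point z, W for "upper semi-Weyl", B for "bounded below" and P for "punctured
invertible" (z is not an accumulation point of the spectrum), all for T - z; primes refer to T + K.
Since W means left-invertible plus finite rank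
(`isUpperSemiWeyl_iff_isLeftInvertibleAddFiniteRank`), W and W' agree. Since K commutes with T and
has finite rank, P and P' agree (`IsPuncturedInvertible.add_finiteRank`). Moreover Browder is W and
P together (`isBrowder_iff`).

Property (UW_E) says pointwise that W holds iff B, or P with nonzero kernel. It places a point of
ρ_vv outside the closure of σ_CI in P (`PropertyUWE.isPuncturedInvertible`); conversely P puts z in
ρ_vv and outside that closure, and B puts z in ρ_vv. Taking complements, condition 3 becomes: (W and
P) or B' holds iff P or B does. As W and P force invertibility or a nonzero kernel, the equivalences
are then propositional at each z. Index theory is avoided throughout: its role is played by the fact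
that an injective or surjective operator of the form unit plus finite rank is a unit. -/

open Filter Topology

/-! ### Limits of units and one-sided inverses. -/

section NormedAlgebra

variable {A : Type*} [NormedRing A] [NormedAlgebra ℂ A]

theorem tendsto_sub_smul_one (a : A) : Tendsto (fun μ : ℂ => a - μ • (1 : A)) (𝓝 0) (𝓝 a) := by
  have : Continuous fun μ : ℂ => a - μ • (1 : A) := by fun_prop
  simpa using this.tendsto 0

/-- If `0` is not an accumulation point of the spectrum, then the element is a limit of units. -/
theorem mem_closure_isUnit_of_eventually {a : A}
    (h : ∀ᶠ μ : ℂ in 𝓝[≠] 0, IsUnit (a - μ • (1 : A))) : a ∈ closure {x : A | IsUnit x} :=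
  mem_closure_of_tendsto ((tendsto_sub_smul_one a).mono_left nhdsWithin_le_nhds) h

end NormedAlgebra

section NormedRing

variable {A : Type*} [NormedRing A] [CompleteSpace A]

/-- In a complete normed ring, a left-invertible limit of units is a unit. -/
theorem isUnit_of_leftInverse_of_mem_closure {l a : A} (h : l * a = 1)
    (ha : a ∈ closure {x : A | IsUnit x}) : IsUnit a := by
  -- This open set contains a, hence some unit x; then l * x and x are units, so l is one too.
  have hopen : IsOpen {x : A | IsUnit (l * x)} :=
    Units.isOpen.preimage (continuous_const.mul continuous_id)
  obtain ⟨x, hlx, hx⟩ := mem_closure_iff.1 ha _ hopen (by simp [h])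
  obtain ⟨u, rfl⟩ := hx
  have hl : IsUnit l := (Units.isUnit_mul_units l u).1 hlx
  obtain ⟨v, rfl⟩ := hl
  have : a = ↑v⁻¹ := by rw [← v.inv_mul_cancel_left a, h, mul_one]
  rw [this]
  exact Units.isUnit _

/-- In a complete normed ring, a right-invertible limit of units is a unit. -/
theorem isUnit_of_rightInverse_of_mem_closure {r a : A} (h : a * r = 1)
    (ha : a ∈ closure {x : A | IsUnit x}) : IsUnit a := by
  have hopen : IsOpen {x : A | IsUnit (x * r)} :=
    Units.isOpen.preimage (continuous_id.mul continuous_const)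
  obtain ⟨x, hrx, hx⟩ := mem_closure_iff.1 ha _ hopen (by simp [h])
  obtain ⟨u, rfl⟩ := hx
  have hr : IsUnit r := (Units.isUnit_units_mul u r).1 hrx
  obtain ⟨v, rfl⟩ := hr
  have : a = ↑v⁻¹ := by rw [← v.mul_inv_cancel_right a, h, one_mul]
  rw [this]
  exact Units.isUnit _

variable [NormedAlgebra ℂ A]

/-- Left invertibility is stable under small scalar perturbations. -/
theorem eventually_exists_leftInverse_sub {l a : A} (h : l * a = 1) :
    ∀ᶠ μ : ℂ in 𝓝 0, ∃ l', l' * (a - μ • (1 : A)) = 1 := by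
  have hopen : IsOpen {x : A | IsUnit (l * x)} :=
    Units.isOpen.preimage (continuous_const.mul continuous_id)
  filter_upwards [(tendsto_sub_smul_one a).eventually (hopen.mem_nhds (by simp [h]))] with μ hμ
  obtain ⟨u, hu⟩ := hμ
  exact ⟨↑u⁻¹ * l, by rw [mul_assoc, ← hu, Units.inv_mul]⟩

/-- Right invertibility is stable under small scalar perturbations. -/
theorem eventually_exists_rightInverse_sub {r a : A} (h : a * r = 1) :
    ∀ᶠ μ : ℂ in 𝓝 0, ∃ r', (a - μ • (1 : A)) * r' = 1 := by
  have hopen : IsOpen {x : A | IsUnit (x * r)} :=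
    Units.isOpen.preimage (continuous_id.mul continuous_const)
  filter_upwards [(tendsto_sub_smul_one a).eventually (hopen.mem_nhds (by simp [h]))] with μ hμ
  obtain ⟨u, hu⟩ := hμ
  exact ⟨r * ↑u⁻¹, by rw [← mul_assoc, ← hu, Units.mul_inv]⟩

end NormedRing

namespace ContinuousLinearMap

/-! ### Finite rank perturbations of invertible and left-invertible operators. -/

section UnitAddFiniteRank

variable {H : Type*} [NormedAddCommGroup H] [InnerProductSpace ℂ H]

theorem hasFiniteRange_add {F G : H →L[ℂ] H} (hF : (F : H →ₗ[ℂ] H).HasFiniteRange)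
    (hG : (G : H →ₗ[ℂ] H).HasFiniteRange) : ((F + G : H →L[ℂ] H) : H →ₗ[ℂ] H).HasFiniteRange :=
  hF.add hG

theorem hasFiniteRange_mul_left {F : H →L[ℂ] H} (L : H →L[ℂ] H)
    (hF : (F : H →ₗ[ℂ] H).HasFiniteRange) : ((L * F : H →L[ℂ] H) : H →ₗ[ℂ] H).HasFiniteRange :=
  hF.comp_left (L : H →ₗ[ℂ] H)

theorem hasFiniteRange_mul_right {F : H →L[ℂ] H} (R : H →L[ℂ] H)
    (hF : (F : H →ₗ[ℂ] H).HasFiniteRange) : ((F * R : H →L[ℂ] H) : H →ₗ[ℂ] H).HasFiniteRange :=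
  hF.comp_right (R : H →ₗ[ℂ] H)

theorem hasFiniteRange_neg {F : H →L[ℂ] H}
    (hF : (F : H →ₗ[ℂ] H).HasFiniteRange) : ((-F : H →L[ℂ] H) : H →ₗ[ℂ] H).HasFiniteRange :=
  hF.neg

/-- For `F` of finite rank, `1 + F` is injective if and only if it is surjective. -/
theorem one_add_injective_iff_surjective {F : H →L[ℂ] H}
    (hF : (F : H →ₗ[ℂ] H).HasFiniteRange) :
    Function.Injective (1 + F : H →L[ℂ] H) ↔ Function.Surjective (1 + F : H →L[ℂ] H) := by
  have : FiniteDimensional ℂ (F : H →ₗ[ℂ] H).range := Module.Finite.iff_fg.2 hF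
  set R := (F : H →ₗ[ℂ] H).range with hR
  have hFR : ∀ x, F x ∈ R := fun x => ⟨x, rfl⟩
  have hmaps : ∀ x ∈ R, ((1 + F : H →L[ℂ] H) : H →ₗ[ℂ] H) x ∈ R := fun x hx => R.add_mem hx (hFR x)
  -- 1 + F preserves R and is the identity modulo R, so both properties are decided on the
  -- finite-dimensional R.
  have key := LinearMap.injective_iff_surjective
    (f := ((1 + F : H →L[ℂ] H) : H →ₗ[ℂ] H).restrict hmaps)
  constructor
  · intro h
    have hs := key.1 fun x y hxy => Subtype.ext (h (congrArg Subtype.val hxy))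
    intro y
    obtain ⟨z, hz⟩ := hs ⟨-F y, R.neg_mem (hFR y)⟩
    have hz' : (z : H) + F z = -F y := congrArg Subtype.val hz
    refine ⟨y + z, ?_⟩
    change y + z + F (y + z) = y
    rw [map_add, add_add_add_comm, hz', add_neg_cancel_right]
  · intro h
    have hi := key.2 fun r => by
      obtain ⟨x, hx⟩ := h r
      have hx' : x + F x = r := hx
      have hxR : x ∈ R := by
        rw [eq_sub_of_add_eq hx']
        exact R.sub_mem r.2 (hFR x)
      exact ⟨⟨x, hxR⟩, Subtype.ext hx'⟩
    refine (injective_iff_map_eq_zero _).2 fun x hx => ?_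
    have hx' : x + F x = 0 := hx
    have hxR : x ∈ R := by
      rw [eq_neg_of_add_eq_zero_left hx']
      exact R.neg_mem (hFR x)
    have : (⟨x, hxR⟩ : R) = 0 := (injective_iff_map_eq_zero _).1 hi _ (Subtype.ext hx')
    exact congrArg Subtype.val this

/-- `T` is an invertible operator plus a finite rank operator. -/
def IsUnitAddFiniteRank (T : H →L[ℂ] H) : Prop :=
  ∃ V F : H →L[ℂ] H, IsUnit V ∧ (F : H →ₗ[ℂ] H).HasFiniteRange ∧ T = V + F

/-- `T` is a left-invertible operator plus a finite rank operator. -/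
def IsLeftInvertibleAddFiniteRank (T : H →L[ℂ] H) : Prop :=
  ∃ A F L : H →L[ℂ] H, L * A = 1 ∧ (F : H →ₗ[ℂ] H).HasFiniteRange ∧ T = A + F

theorem IsUnitAddFiniteRank.isLeftInvertibleAddFiniteRank {T : H →L[ℂ] H}
    (h : T.IsUnitAddFiniteRank) : T.IsLeftInvertibleAddFiniteRank := by
  obtain ⟨_, F, ⟨u, rfl⟩, hF, rfl⟩ := h
  exact ⟨u, F, ↑u⁻¹, u.inv_mul, hF, rfl⟩

theorem IsUnitAddFiniteRank.add_finiteRank {T K : H →L[ℂ] H}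
    (h : T.IsUnitAddFiniteRank) (hK : (K : H →ₗ[ℂ] H).HasFiniteRange) :
    (T + K).IsUnitAddFiniteRank := by
  obtain ⟨V, F, hV, hF, rfl⟩ := h
  exact ⟨V, F + K, hV, hasFiniteRange_add hF hK, add_assoc _ _ _⟩

theorem IsLeftInvertibleAddFiniteRank.add_finiteRank {T K : H →L[ℂ] H}
    (h : T.IsLeftInvertibleAddFiniteRank) (hK : (K : H →ₗ[ℂ] H).HasFiniteRange) :
    (T + K).IsLeftInvertibleAddFiniteRank := by
  obtain ⟨A, F, L, hA, hF, rfl⟩ := h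
  exact ⟨A, F + K, L, hA, hasFiniteRange_add hF hK, add_assoc _ _ _⟩

theorem IsUnitAddFiniteRank.mul {S T : H →L[ℂ] H} (hS : S.IsUnitAddFiniteRank)
    (hT : T.IsUnitAddFiniteRank) : (S * T).IsUnitAddFiniteRank := by
  obtain ⟨V, F, hV, hF, rfl⟩ := hS
  obtain ⟨W, G, hW, hG, rfl⟩ := hT
  refine ⟨V * W, V * G + F * (W + G), hV.mul hW,
    hasFiniteRange_add (hasFiniteRange_mul_left V hG) (hasFiniteRange_mul_right _ hF), ?_⟩
  noncomm_ring

theorem IsUnitAddFiniteRank.pow {T : H →L[ℂ] H} (hT : T.IsUnitAddFiniteRank) (n : ℕ) :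
    (T ^ n).IsUnitAddFiniteRank := by
  induction n with
  | zero => exact ⟨1, 0, isUnit_one, LinearMap.HasFiniteRange.zero, by simp⟩
  | succ n ih => rw [pow_succ]; exact ih.mul hT

variable [CompleteSpace H]

/-- Factoring u + F = u(1 + u⁻¹F) reduces this to the Fredholm alternative for the identity plus
finite rank. -/
theorem isUnit_of_isUnitAddFiniteRank_aux {T : H →L[ℂ] H} (hT : T.IsUnitAddFiniteRank)
    (h : Function.Injective T ∨ Function.Surjective T) : IsUnit T := by
  obtain ⟨_, F, ⟨u, rfl⟩, hF, rfl⟩ := hT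
  have hu : Function.Bijective (u : H →L[ℂ] H) := isUnit_iff_bijective.1 u.isUnit
  have heq : (u : H →L[ℂ] H) + F = u * (1 + ↑u⁻¹ * F) := by
    rw [mul_add, mul_one, Units.mul_inv_cancel_left]
  have hcoe : ⇑((u : H →L[ℂ] H) + F) = (u : H →L[ℂ] H) ∘ (1 + ↑u⁻¹ * F : H →L[ℂ] H) := by
    rw [heq]; rfl
  have key := one_add_injective_iff_surjective (hasFiniteRange_mul_left (↑u⁻¹) hF)
  rw [heq]
  refine u.isUnit.mul (isUnit_iff_bijective.2 ?_)
  rw [hcoe] at h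
  rcases h with h | h
  · exact ⟨h.of_comp, key.1 h.of_comp⟩
  · have hs := (Function.Surjective.of_comp_iff' hu _).1 h
    exact ⟨key.2 hs, hs⟩

theorem IsUnitAddFiniteRank.isUnit_of_injective {T : H →L[ℂ] H} (hT : T.IsUnitAddFiniteRank)
    (h : Function.Injective T) : IsUnit T :=
  isUnit_of_isUnitAddFiniteRank_aux hT (.inl h)

theorem IsUnitAddFiniteRank.isUnit_of_surjective {T : H →L[ℂ] H} (hT : T.IsUnitAddFiniteRank)
    (h : Function.Surjective T) : IsUnit T :=
  isUnit_of_isUnitAddFiniteRank_aux hT (.inr h)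

theorem exists_leftInverse_of_injective_of_isClosed_range {T : H →L[ℂ] H}
    (hi : Function.Injective T) (hc : IsClosed (T.range : Set H)) :
    ∃ L : H →L[ℂ] H, L * T = 1 := by
  have : CompleteSpace T.range := hc.completeSpace_coe
  obtain ⟨L, hL⟩ := HasLeftInverse.of_injective_of_isClosed_range_of_closedComplement_range hi
    hc
    ⟨T.range.orthogonalProjectionOnto, T.range.orthogonalProjectionOnto_mem_subspace_eq_self⟩
  exact ⟨L, ext hL⟩

theorem isBoundedBelow_iff_exists_leftInverse {T : H →L[ℂ] H} :
    T.IsBoundedBelow ↔ ∃ L : H →L[ℂ] H, L * T = 1 := by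
  constructor
  · rintro ⟨c, hc, h⟩
    have hanti : AntilipschitzWith (Real.toNNReal c⁻¹) T := by
      refine AddMonoidHomClass.antilipschitz_of_bound T fun x => ?_
      rw [Real.coe_toNNReal _ (by positivity), inv_mul_eq_div, le_div_iff₀ hc, mul_comm]
      exact h x
    exact exists_leftInverse_of_injective_of_isClosed_range hanti.injective
      (hanti.isClosed_range T.uniformContinuous)
  · rintro ⟨L, hL⟩
    -- Adding 1 keeps the constant positive even if L = 0, which happens on the zero space.
    refine ⟨(‖L‖ + 1)⁻¹, by positivity, fun x => ?_⟩
    rw [inv_mul_le_iff₀ (by positivity)]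
    calc ‖x‖ = ‖L (T x)‖ := by rw [show L (T x) = x from congr($hL x)]
      _ ≤ ‖L‖ * ‖T x‖ := L.le_opNorm _
      _ ≤ (‖L‖ + 1) * ‖T x‖ := by gcongr; linarith

/-- T restricts to a continuous bijection from the orthogonal complement of its kernel, whose
inverse is bounded. -/
theorem exists_mul_eq_one_of_surjective {T : H →L[ℂ] H} (hs : Function.Surjective T) :
    ∃ R : H →L[ℂ] H, T * R = 1 := by
  have hker : IsClosed (T.ker : Set H) := T.isClosed_ker
  have : CompleteSpace T.ker := hker.completeSpace_coe
  set S : T.kerᗮ →L[ℂ] H := T ∘L T.kerᗮ.subtypeL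
  have hSi : (S : T.kerᗮ →ₗ[ℂ] H).ker = ⊥ := by
    refine LinearMap.ker_eq_bot'.2 fun x hx => Subtype.ext ?_
    exact (Submodule.disjoint_def.1 T.ker.orthogonal_disjoint) x hx x.2
  have hSs : (S : T.kerᗮ →ₗ[ℂ] H).range = ⊤ := by
    refine LinearMap.range_eq_top.2 fun y => ?_
    obtain ⟨x, rfl⟩ := hs y
    refine ⟨⟨x - T.ker.starProjection x, T.ker.sub_starProjection_mem_orthogonal x⟩, ?_⟩
    change T (x - T.ker.starProjection x) = T x
    have : T (T.ker.starProjection x) = 0 := T.ker.starProjection_apply_mem x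
    rw [map_sub, this, sub_zero]
  let e := ContinuousLinearEquiv.ofBijective S hSi hSs
  refine ⟨T.kerᗮ.subtypeL ∘L (e.symm : H →L[ℂ] T.kerᗮ), ext fun y => ?_⟩
  exact e.apply_symm_apply y

end UnitAddFiniteRank

/-! ### Upper semi-Weyl operators as left-invertible plus finite rank. -/

section UpperSemiWeyl

variable {H : Type*} [NormedAddCommGroup H] [InnerProductSpace ℂ H]

theorem nullity_lt_top_iff {T : H →L[ℂ] H} : T.nullity < ⊤ ↔ FiniteDimensional ℂ T.ker := by
  rw [nullity, Cardinal.toENat_lt_top, Module.rank_lt_aleph0_iff]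

theorem defect_lt_top_iff {T : H →L[ℂ] H} :
    T.defect < ⊤ ↔ FiniteDimensional ℂ (H ⧸ T.range) := by
  rw [defect, Cardinal.toENat_lt_top, Module.rank_lt_aleph0_iff]

theorem nullity_pos_iff {T : H →L[ℂ] H} : 0 < T.nullity ↔ T.ker ≠ ⊥ := by
  rw [pos_iff_ne_zero, nullity, ne_eq, Cardinal.toENat_eq_zero, rank_zero_iff,
    Submodule.subsingleton_iff_eq_bot]

/-- Nonpositive index bounds the nullity by the defect, so the lower semi-Fredholm case is absorbed
by the upper one. -/
theorem isUpperSemiWeyl_iff {T : H →L[ℂ] H} :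
    T.IsUpperSemiWeyl ↔
      FiniteDimensional ℂ T.ker ∧ IsClosed (T.range : Set H) ∧ T.nullity ≤ T.defect := by
  rw [IsUpperSemiWeyl, IsSemiFredholm, IsUpperSemiFredholm, IsLowerSemiFredholm, index,
    EReal.sub_nonpos, EReal.coe_ennreal_le_coe_ennreal_iff, ENat.toENNReal_le,
    ← nullity_lt_top_iff]
  constructor
  · rintro ⟨⟨h1, h2⟩ | ⟨h1, h2⟩, h3⟩
    exacts [⟨h1, h2, h3⟩, ⟨h3.trans_lt h1, h2, h3⟩]
  · rintro ⟨h1, h2, h3⟩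
    exact ⟨.inl ⟨h1, h2⟩, h3⟩

theorem IsLeftInvertibleAddFiniteRank.finiteDimensional_ker {T : H →L[ℂ] H}
    (h : T.IsLeftInvertibleAddFiniteRank) : FiniteDimensional ℂ T.ker := by
  obtain ⟨A, F, L, hL, hF, rfl⟩ := h
  have : FiniteDimensional ℂ (L * F).range :=
    Module.Finite.iff_fg.2 (hasFiniteRange_mul_left L hF)
  refine Submodule.finiteDimensional_of_le (S₂ := (L * F).range) fun x hx => ⟨-x, ?_⟩
  have hx' : A x + F x = 0 := hx
  have hLA : L (A x) = x := congr($hL x)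
  change L (F (-x)) = x
  rw [map_neg, ← eq_neg_of_add_eq_zero_left hx', hLA]

/-- It suffices that the image of the finite-codimensional kernel of F is closed. There T agrees
with A, and the image is cut out by the closed conditions ALy = y and FLy = 0. -/
theorem IsLeftInvertibleAddFiniteRank.isClosed_range {T : H →L[ℂ] H}
    (h : T.IsLeftInvertibleAddFiniteRank) : IsClosed (T.range : Set H) := by
  obtain ⟨A, F, L, hL, hF, rfl⟩ := h
  have hLA : ∀ x, L (A x) = x := fun x => congr($hL x)
  have : (F : H →ₗ[ℂ] H).ker.CoFG := hF.cofg_ker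
  refine LinearMap.isClosed_range_of_isClosed_map_of_finiteDimensional_quotient
    (s := (F : H →ₗ[ℂ] H).ker) ?_
  have heq : ((F : H →ₗ[ℂ] H).ker.map ((A + F : H →L[ℂ] H) : H →ₗ[ℂ] H) : Set H) =
      {y | A (L y) = y} ∩ {y | F (L y) = 0} := by
    ext y
    constructor
    · rintro ⟨x, hx, rfl⟩
      have hx' : F x = 0 := hx
      have : ((A + F : H →L[ℂ] H) : H →ₗ[ℂ] H) x = A x := by
        change A x + F x = A x
        rw [hx', add_zero]
      rw [this]
      exact ⟨congrArg A (hLA x), by rw [Set.mem_ofPred_eq, hLA, hx']⟩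
    · rintro ⟨h1, h2⟩
      refine ⟨L y, h2, ?_⟩
      change A (L y) + F (L y) = y
      rw [h1, h2, add_zero]
  rw [heq]
  exact (isClosed_eq (by fun_prop) (by fun_prop)).inter (isClosed_eq (by fun_prop) (by fun_prop))

/-- Given a linear map from the kernel of `T` to the cokernel of `T`, perturb `T` by the
corresponding finite rank operator. -/
theorem exists_finiteRank_add [CompleteSpace H] {T : H →L[ℂ] H} [FiniteDimensional ℂ T.ker]
    (g : T.ker →ₗ[ℂ] H ⧸ T.range) :
    ∃ F : H →L[ℂ] H, (F : H →ₗ[ℂ] H).HasFiniteRange ∧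
      (IsClosed (T.range : Set H) → Function.Injective g → ∃ L, L * (T + F) = 1) ∧
      (Function.Surjective g → Function.Surjective (T + F)) ∧
      (¬ Function.Injective g → ¬ Function.Injective (T + F)) := by
  -- The section s is only linear; s ∘ g is continuous because the kernel is finite-dimensional.
  obtain ⟨s, hs⟩ := T.range.mkQ.exists_rightInverse_of_surjective T.range.range_mkQ
  have hs' : ∀ q, T.range.mkQ (s q) = q := fun q => congr($hs q)
  let j : T.ker →L[ℂ] H := LinearMap.toContinuousLinearMap (s ∘ₗ g)
  have hj : ∀ n, T.range.mkQ (j n) = g n := fun n => hs' _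
  have hjfin : (j : T.ker →ₗ[ℂ] H).HasFiniteRange := .of_finite_dom
  set F : H →L[ℂ] H := j ∘L T.ker.orthogonalProjectionOnto with hFdef
  have hF : (F : H →ₗ[ℂ] H).HasFiniteRange :=
    hjfin.comp_right (T.ker.orthogonalProjectionOnto : H →ₗ[ℂ] T.ker)
  have hFn : ∀ n : T.ker, F n = j n := fun n => by
    simp [hFdef]
  have hTn : ∀ n : T.ker, T n = 0 := fun n => n.2
  have hmk : ∀ x, T.range.mkQ (T x) = 0 := fun x =>
    (Submodule.Quotient.mk_eq_zero _).2 ⟨x, rfl⟩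
  refine ⟨F, hF, fun hc hg => ?_, fun hg y => ?_, fun hg hinj => hg ?_⟩
  · refine exists_leftInverse_of_injective_of_isClosed_range ?_ ?_
    · refine (injective_iff_map_eq_zero _).2 fun x hx => ?_
      have hx' : T x + j (T.ker.orthogonalProjectionOnto x) = 0 := hx
      have h1 : g (T.ker.orthogonalProjectionOnto x) = 0 := by
        rw [← hj, eq_neg_of_add_eq_zero_right hx', map_neg, hmk, neg_zero]
      have h2 : T.ker.orthogonalProjectionOnto x = 0 := hg (by rw [h1, map_zero])
      rw [h2, map_zero, add_zero] at hx'
      have h3 := T.ker.orthogonalProjectionOnto_mem_subspace_eq_self ⟨x, hx'⟩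
      rw [h2] at h3
      exact congrArg Subtype.val h3.symm
    · have heq : (T + F).range = T.range ⊔ (j : T.ker →ₗ[ℂ] H).range := by
        apply le_antisymm
        · rintro _ ⟨x, rfl⟩
          exact Submodule.add_mem_sup ⟨x, rfl⟩ ⟨_, rfl⟩
        · refine sup_le ?_ ?_
          · rintro _ ⟨x, rfl⟩
            refine ⟨x - T.ker.orthogonalProjectionOnto x, ?_⟩
            change T (x - _) + F (x - _) = T x
            rw [map_sub, map_sub, hFn, hTn, hFdef]
            simp
          · rintro _ ⟨n, rfl⟩
            refine ⟨n, ?_⟩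
            change T n + F n = j n
            rw [hFn, hTn, zero_add]
      rw [heq]
      exact Submodule.isClosed_sup_finiteDimensional _ _ hc
  · obtain ⟨n, hn⟩ := hg (T.range.mkQ y)
    have : T.range.mkQ (y - j n) = 0 := by rw [map_sub, hj, hn, sub_self]
    obtain ⟨x, hx⟩ := (Submodule.Quotient.mk_eq_zero _).1 this
    have hx' : T x = y - j n := hx
    refine ⟨x - T.ker.orthogonalProjectionOnto x + n, ?_⟩
    change T (x - _ + n) + F (x - _ + n) = y
    rw [map_add, map_add, map_sub, map_sub, hFn, hFn, hTn, hTn, hx', hFdef]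
    simp
  · refine (injective_iff_map_eq_zero _).2 fun n hn => Subtype.ext (hinj ?_)
    change T n + F n = (T + F) 0
    have : j n = 0 := by
      change s (g n) = 0
      rw [hn, map_zero]
    rw [hFn, hTn, this, map_zero, add_zero]

variable [CompleteSpace H]

theorem IsUpperSemiWeyl.isLeftInvertibleAddFiniteRank {T : H →L[ℂ] H} (h : T.IsUpperSemiWeyl) :
    T.IsLeftInvertibleAddFiniteRank := by
  obtain ⟨hfin, hc, hle⟩ := isUpperSemiWeyl_iff.1 h
  obtain ⟨g, hg⟩ : ∃ g : T.ker →ₗ[ℂ] H ⧸ T.range, Function.Injective g := by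
    have hle' := (Cardinal.toENat_le_iff_of_le_aleph0
      (Module.rank_lt_aleph0_iff.2 hfin).le).1 hle
    let b := Module.Basis.ofVectorSpace ℂ (H ⧸ T.range)
    exact Module.Free.exists_linearMap_injective_of_linearIndependent_of_rank_le
      b.linearIndependent (hle'.trans_eq b.mk_eq_rank''.symm)
  obtain ⟨F, hF, h1, -, -⟩ := exists_finiteRank_add g
  obtain ⟨L, hL⟩ := h1 hc hg
  exact ⟨T + F, -F, L, hL, hasFiniteRange_neg hF, by abel⟩

/-- If the defect were smaller, a finite rank G would make T + G surjective but not injective, with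
a right inverse R. Then AR is injective and equals 1 minus finite rank, so it is a unit and A is
invertible. Hence T + G is unit plus finite rank, and surjectivity forces injectivity. -/
theorem IsLeftInvertibleAddFiniteRank.nullity_le_defect {T : H →L[ℂ] H}
    (h : T.IsLeftInvertibleAddFiniteRank) : T.nullity ≤ T.defect := by
  have hfin := h.finiteDimensional_ker
  obtain ⟨A, F, L, hL, hF, hT⟩ := h
  by_contra! hlt
  have hfin' : FiniteDimensional ℂ (H ⧸ T.range) := defect_lt_top_iff.1 (hlt.trans_le le_top)
  have hlt' : Module.finrank ℂ (H ⧸ T.range) < Module.finrank ℂ T.ker := by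
    rw [nullity, defect, ← Module.finrank_eq_rank, ← Module.finrank_eq_rank, map_natCast,
      map_natCast] at hlt
    exact_mod_cast hlt
  obtain ⟨i, hi⟩ : ∃ i : (H ⧸ T.range) →ₗ[ℂ] T.ker, Function.Injective i :=
    Module.Free.exists_linearMap_injective_of_rank_lt (by
      rw [← Module.finrank_eq_rank, ← Module.finrank_eq_rank]; exact_mod_cast hlt')
  obtain ⟨g, hg⟩ := i.exists_leftInverse_of_injective (LinearMap.ker_eq_bot.2 hi)
  have hgs : Function.Surjective g := fun q => ⟨i q, congr($hg q)⟩
  have hgi : ¬ Function.Injective g := fun hinj =>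
    g.ker_ne_bot_of_finrank_lt hlt' (LinearMap.ker_eq_bot.2 hinj)
  obtain ⟨G, hG, -, h2, h3⟩ := exists_finiteRank_add g
  obtain ⟨R, hR⟩ := exists_mul_eq_one_of_surjective (h2 hgs)
  have hAR : (A * R).IsUnitAddFiniteRank := by
    refine ⟨1, -((F + G) * R), isUnit_one,
      hasFiniteRange_neg (hasFiniteRange_mul_right R (hasFiniteRange_add hF hG)), ?_⟩
    rw [← hR, hT]
    noncomm_ring
  have hinj : Function.Injective (A * R) := by
    have h1 : Function.LeftInverse L A := fun x => congr($hL x)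
    have h2 : Function.LeftInverse (T + G) R := fun x => congr($hR x)
    exact h1.injective.comp h2.injective
  have hu : IsUnit (A * R) := hAR.isUnit_of_injective hinj
  have hA : IsUnit A := by
    refine isUnit_iff_bijective.2 ⟨?_, ?_⟩
    · have h1 : Function.LeftInverse L A := fun x => congr($hL x)
      exact h1.injective
    · have := (isUnit_iff_bijective.1 hu).2
      exact Function.Surjective.of_comp (f := A) (g := R) this
  have hTG : (T + G).IsUnitAddFiniteRank :=
    ⟨A, F + G, hA, hasFiniteRange_add hF hG, by rw [hT, add_assoc]⟩
  exact h3 hgi (isUnit_iff_bijective.1 (hTG.isUnit_of_surjective (h2 hgs))).1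

/-- An operator is upper semi-Weyl if and only if it is the sum of a left-invertible operator and
a finite rank operator. -/
theorem isUpperSemiWeyl_iff_isLeftInvertibleAddFiniteRank {T : H →L[ℂ] H} :
    T.IsUpperSemiWeyl ↔ T.IsLeftInvertibleAddFiniteRank :=
  ⟨IsUpperSemiWeyl.isLeftInvertibleAddFiniteRank, fun h => isUpperSemiWeyl_iff.2
    ⟨h.finiteDimensional_ker, h.isClosed_range, h.nullity_le_defect⟩⟩

theorem IsUpperSemiWeyl.add_finiteRank {T K : H →L[ℂ] H} (h : T.IsUpperSemiWeyl)
    (hK : (K : H →ₗ[ℂ] H).HasFiniteRange) : (T + K).IsUpperSemiWeyl :=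
  isUpperSemiWeyl_iff_isLeftInvertibleAddFiniteRank.2
    (h.isLeftInvertibleAddFiniteRank.add_finiteRank hK)

end UpperSemiWeyl

end ContinuousLinearMap

/-! ### Elements nilpotent on a commuting idempotent. -/

section Ring

variable {A : Type*} [Ring A] {t p : A} {n : ℕ}

theorem isUnit_of_mul_eq_of_commute {a b u : A} (hab : Commute a b)
    (hu : IsUnit u) (h : a * b = u) : IsUnit a :=
  (hab.isUnit_mul_iff.1 (h ▸ hu)).1

theorem isNilpotent_mul_of_pow_mul_eq_zero (hc : Commute t p) (hn : t ^ (n + 1) * p = 0) :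
    IsNilpotent (t * p) := by
  refine ⟨n + 1, ?_⟩
  rw [hc.mul_pow, pow_succ p n, ← mul_assoc, (hc.pow_pow _ _).eq, mul_assoc, hn, mul_zero]

/-- If `t` commutes with the idempotent `p`, is nilpotent on `p`, and `t ^ (n + 1) + p` is a unit,
then `t + p` is a unit. -/
theorem isUnit_add_idempotent (hp : p * p = p) (hc : Commute t p) (hn : t ^ (n + 1) * p = 0)
    (hu : IsUnit (t ^ (n + 1) + p)) : IsUnit (t + p) := by
  have hnil := isNilpotent_mul_of_pow_mul_eq_zero hc hn
  obtain ⟨w, hw⟩ := hnil.isUnit_one_add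
  have hwt : Commute (t + p) (w : A) := by
    rw [hw]
    exact (Commute.one_right _).add_right
      (((Commute.refl t).add_left hc.symm).mul_right (hc.add_left (Commute.refl p)))
  have hwp : (t + p) * p = w * p := by
    rw [hw, add_mul, add_mul, one_mul, mul_assoc, hp, add_comm]
  -- On p, t + p acts as w = 1 + tp. The cofactor inverts that part and completes t to t ^ (n + 1)
  -- off p, so the product is the given unit.
  have h1 : Commute (t + p) (t ^ n * (1 - p) + p * ↑w⁻¹) :=
    ((((Commute.refl t).add_left hc.symm).pow_right n).mul_right ((Commute.one_right _).sub_right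
      (hc.add_left (Commute.refl p)))).add_right
      ((hc.add_left (Commute.refl p)).mul_right hwt.units_inv_right)
  refine isUnit_of_mul_eq_of_commute h1 hu ?_
  have h2 : (t + p) * (p * ↑w⁻¹) = p := by
    have h3 : Commute p (w : A) := by
      rw [hw]
      exact (Commute.one_right _).add_right (hc.symm.mul_right (Commute.refl p))
    rw [← mul_assoc, hwp, ← h3.eq, Units.mul_inv_cancel_right]
  have h4 : (t + p) * (t ^ n * (1 - p)) = t ^ (n + 1) := by
    have h5 : p * (t ^ n * (1 - p)) = 0 := by
      rw [← mul_assoc, ← (hc.pow_left n).eq, mul_assoc, mul_sub, mul_one, hp, sub_self, mul_zero]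
    rw [add_mul, h5, add_zero, ← mul_assoc, ← pow_succ', mul_sub, mul_one, hn, sub_zero]
  rw [mul_add, h2, h4]

/-- If `t` commutes with the idempotent `p`, is nilpotent on `p`, and `t ^ (n + 1) + p` is a unit,
then `t - μ` is a unit for all small nonzero `μ`. -/
theorem eventually_isUnit_sub_of_idempotent {A : Type*} [NormedRing A] [NormedAlgebra ℂ A]
    [CompleteSpace A] {t p : A} {n : ℕ} (hp : p * p = p) (hc : Commute t p)
    (hn : t ^ (n + 1) * p = 0) (hu : IsUnit (t ^ (n + 1) + p)) :
    ∀ᶠ μ : ℂ in 𝓝[≠] 0, IsUnit (t - μ • (1 : A)) := by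
  have hnil := isNilpotent_mul_of_pow_mul_eq_zero hc hn
  have hcont : Tendsto (fun μ : ℂ => t ^ (n + 1) + p - μ • (t ^ n * (1 - p))) (𝓝 0)
      (𝓝 (t ^ (n + 1) + p)) := by
    have : Continuous fun μ : ℂ => t ^ (n + 1) + p - μ • (t ^ n * (1 - p)) := by fun_prop
    simpa using this.tendsto 0
  filter_upwards [(hcont.eventually (Units.isOpen.mem_nhds hu)).filter_mono nhdsWithin_le_nhds,
    self_mem_nhdsWithin] with μ hμ hμ0
  have hscal : ∀ a : A, Commute a (μ • (1 : A)) := fun a => by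
    rw [Commute, SemiconjBy, mul_smul_comm, smul_mul_assoc, mul_one, one_mul]
  have hμu : IsUnit (-(μ • (1 : A))) :=
    by
    rw [← Algebra.algebraMap_eq_smul_one]
    exact ((Units.mk0 μ hμ0).isUnit.map (algebraMap ℂ A)).neg
  obtain ⟨w, hw⟩ : IsUnit (-(μ • (1 : A)) + t * p) :=
    hnil.isUnit_add_left_of_commute hμu (hscal _).neg_right
  have htc : ∀ a : A, Commute t a → Commute (t - μ • (1 : A)) a := fun a ha =>
    ha.sub_left (hscal a).symm
  have hwt : Commute (t - μ • (1 : A)) (w : A) := by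
    rw [hw]
    exact htc _ ((hscal _).neg_right.add_right ((Commute.refl t).mul_right hc))
  have hwp : (t - μ • (1 : A)) * p = w * p := by
    rw [hw, sub_mul, add_mul, mul_assoc t, hp, neg_mul, sub_eq_add_neg, add_comm]
  have h3 : Commute p (w : A) := by
    rw [hw]
    exact (hscal _).neg_right.add_right (hc.symm.mul_right (Commute.refl p))
  -- The same cofactor, now with w = -μ + tp; μ ≠ 0 is needed only to invert w.
  refine isUnit_of_mul_eq_of_commute (b := t ^ n * (1 - p) + p * ↑w⁻¹) ?_ hμ ?_
  · exact ((htc _ ((Commute.refl t).pow_right n)).mul_right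
      (htc _ ((Commute.one_right _).sub_right hc))).add_right
      ((htc _ hc).mul_right hwt.units_inv_right)
  · have h2 : (t - μ • (1 : A)) * (p * ↑w⁻¹) = p := by
      rw [← mul_assoc, hwp, ← h3.eq, Units.mul_inv_cancel_right]
    rw [mul_add, h2, sub_mul, smul_mul_assoc, one_mul, ← mul_assoc, ← pow_succ', mul_sub, mul_one,
      hn, sub_zero]
    abel

end Ring

/-! ### Browder operators and isolation of 0 in the spectrum. -/

namespace ContinuousLinearMap

variable {H : Type*} [NormedAddCommGroup H] [InnerProductSpace ℂ H]

theorem ascent_lt_top_iff {T : H →L[ℂ] H} :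
    T.ascent < ⊤ ↔ ∃ n : ℕ, (T ^ n).ker = (T ^ (n + 1)).ker := by
  simp [ascent, iInf_lt_iff]

theorem descent_lt_top_iff {T : H →L[ℂ] H} :
    T.descent < ⊤ ↔ ∃ n : ℕ, (T ^ n).range = (T ^ (n + 1)).range := by
  simp [descent, iInf_lt_iff]

theorem ker_pow_add_eq {T : H →L[ℂ] H} {n : ℕ} (h : (T ^ n).ker = (T ^ (n + 1)).ker) (k : ℕ) :
    (T ^ (n + k)).ker = (T ^ n).ker := by
  induction k with
  | zero => rfl
  | succ k ih =>
    rw [← ih]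
    ext x
    have h1 : x ∈ (T ^ (n + (k + 1))).ker ↔ (T ^ k) x ∈ (T ^ (n + 1)).ker := by
      rw [show n + (k + 1) = n + 1 + k by ring, pow_add]; rfl
    have h2 : x ∈ (T ^ (n + k)).ker ↔ (T ^ k) x ∈ (T ^ n).ker := by
      rw [pow_add]; rfl
    rw [h1, h2, h]

theorem range_pow_add_eq {T : H →L[ℂ] H} {n : ℕ} (h : (T ^ n).range = (T ^ (n + 1)).range)
    (k : ℕ) : (T ^ (n + k)).range = (T ^ n).range := by
  have hr : ∀ a b : ℕ, (T ^ (a + b)).range =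
      (T ^ b).range.map ((T ^ a : H →L[ℂ] H) : H →ₗ[ℂ] H) := fun a b => by
    rw [pow_add]
    exact LinearMap.range_comp _ _
  induction k with
  | zero => rfl
  | succ k ih =>
    rw [← ih, show n + (k + 1) = k + (n + 1) by ring, add_comm n k, hr k, hr k, h]

theorem finiteDimensional_ker_pow {T : H →L[ℂ] H} (h : FiniteDimensional ℂ T.ker) (n : ℕ) :
    FiniteDimensional ℂ (T ^ n).ker := by
  induction n with
  | zero =>
    have : (T ^ 0).ker = ⊥ := LinearMap.ker_eq_bot.2 fun x y hxy => hxy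
    rw [this]
    infer_instance
  | succ n ih =>
    have : (T ^ (n + 1)).ker = (T ^ n).ker.comap (T : H →ₗ[ℂ] H) := by
      rw [pow_succ]; rfl
    rw [this]
    infer_instance

theorem range_pow_le {T : H →L[ℂ] H} {m n : ℕ} (h : m ≤ n) : (T ^ n).range ≤ (T ^ m).range := by
  obtain ⟨k, rfl⟩ := Nat.exists_eq_add_of_le h
  rw [pow_add]
  exact LinearMap.range_comp_le_range _ _

theorem disjoint_ker_range_pow {T : H →L[ℂ] H} {n : ℕ} (h : (T ^ n).ker = (T ^ (n + 1)).ker) :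
    Disjoint (T ^ n).ker (T ^ n).range := by
  refine Submodule.disjoint_def.2 ?_
  rintro _ hx ⟨x, rfl⟩
  have h1 : x ∈ (T ^ (n + n)).ker := by
    rw [pow_add]
    exact hx
  rw [ker_pow_add_eq h] at h1
  exact h1

/-- `0` is not an accumulation point of the spectrum of `T`. -/
def IsPuncturedInvertible (T : H →L[ℂ] H) : Prop :=
  ∀ᶠ μ : ℂ in 𝓝[≠] 0, IsUnit (T - μ • (1 : H →L[ℂ] H))

variable [CompleteSpace H]

/-- For small μ ≠ 0, A - μ is left-invertible and differs from the unit T - μ by finite rank, so it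
is a unit. Thus A is a left-invertible limit of units. -/
theorem IsLeftInvertibleAddFiniteRank.isUnitAddFiniteRank {T : H →L[ℂ] H}
    (h : T.IsLeftInvertibleAddFiniteRank) (hT : T.IsPuncturedInvertible) :
    T.IsUnitAddFiniteRank := by
  obtain ⟨A, F, L, hL, hF, rfl⟩ := h
  refine ⟨A, F, isUnit_of_leftInverse_of_mem_closure hL (mem_closure_isUnit_of_eventually ?_),
    hF, rfl⟩
  filter_upwards [hT, (eventually_exists_leftInverse_sub hL).filter_mono nhdsWithin_le_nhds]
    with μ hμ ⟨L', hL'⟩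
  refine IsUnitAddFiniteRank.isUnit_of_injective
    ⟨A + F - μ • 1, -F, hμ, hasFiniteRange_neg hF, by abel⟩ ?_
  have h1 : Function.LeftInverse L' (A - μ • (1 : H →L[ℂ] H)) := fun x => congr($hL' x)
  exact h1.injective

theorem IsUnitAddFiniteRank.isFredholm {T : H →L[ℂ] H} (h : T.IsUnitAddFiniteRank) :
    T.IsFredholm := by
  have hc := h.isLeftInvertibleAddFiniteRank.isClosed_range
  refine (isFredholm_iff_upper_lower T).2 ⟨⟨nullity_lt_top_iff.2
    h.isLeftInvertibleAddFiniteRank.finiteDimensional_ker, hc⟩, defect_lt_top_iff.2 ?_, hc⟩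
  obtain ⟨V, F, hV, hF, rfl⟩ := h
  refine Submodule.FG.cofg_of_codisjoint (S := (F : H →ₗ[ℂ] H).range) ?_ hF
  refine codisjoint_iff.2 (eq_top_iff.2 fun y _ => ?_)
  obtain ⟨x, rfl⟩ := (isUnit_iff_bijective.1 hV).2 y
  rw [show V x = -F x + (V + F) x by simp]
  exact Submodule.add_mem_sup ⟨-x, map_neg F x⟩ ⟨x, rfl⟩

/-- If `T` is invertible up to finite rank and `0` is not an accumulation point of its spectrum,
then `T` has finite ascent. -/
theorem IsUnitAddFiniteRank.ascent_lt_top {T : H →L[ℂ] H} (h : T.IsUnitAddFiniteRank)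
    (hT : T.IsPuncturedInvertible) : T.ascent < ⊤ := by
  rw [ascent_lt_top_iff]
  by_contra! hne
  have hfin := h.isLeftInvertibleAddFiniteRank.finiteDimensional_ker
  let D : ℕ →o (Submodule ℂ T.ker)ᵒᵈ :=
    ⟨fun n => OrderDual.toDual ((T ^ n).range.comap T.ker.subtype),
      fun m n hmn => Submodule.comap_mono (range_pow_le hmn)⟩
  obtain ⟨n₀, hn₀⟩ := IsArtinian.monotone_stabilizes D
  have hstab : ∀ x ∈ T.ker, x ∈ (T ^ n₀).range → ∀ n, x ∈ (T ^ n).range := by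
    intro x hx hxr n
    rcases le_total n n₀ with hn | hn
    · exact range_pow_le hn hxr
    · have h1 : (T ^ n₀).range.comap T.ker.subtype = (T ^ n).range.comap T.ker.subtype := hn₀ n hn
      have h2 : (⟨x, hx⟩ : T.ker) ∈ (T ^ n₀).range.comap T.ker.subtype := hxr
      rw [h1] at h2
      exact h2
  -- T maps M onto M: preimages in successive ranges differ by kernel elements, and the
  -- intersections of the kernel with these ranges stabilise.
  set M : Submodule ℂ H := ⨅ n : ℕ, (T ^ n).range with hM
  have hMmem : ∀ x, x ∈ M ↔ ∀ n : ℕ, x ∈ (T ^ n).range := fun x => Submodule.mem_iInf _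
  have hMclosed : IsClosed (M : Set H) := by
    rw [hM, Submodule.coe_iInf]
    exact isClosed_iInter fun n => (h.pow n).isLeftInvertibleAddFiniteRank.isClosed_range
  have : CompleteSpace M := hMclosed.completeSpace_coe
  have hmaps : Set.MapsTo T M M := by
    intro x hx
    refine (hMmem _).2 fun n => ?_
    obtain ⟨y, hy⟩ := (hMmem x).1 hx n
    refine ⟨T y, ?_⟩
    have h1 : (T ^ n) (T y) = T ((T ^ n) y) := by
      change (T ^ n * T) y = (T * T ^ n) y
      rw [← pow_succ, ← pow_succ']
    exact h1.trans (congrArg T hy)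
  let S : M →L[ℂ] M := T.restrict hmaps
  have hSval : ∀ x : M, (S x : H) = T x := fun x => rfl
  have hSs : Function.Surjective S := by
    rintro ⟨y, hy⟩
    have hpre : ∀ n : ℕ, ∃ x ∈ (T ^ n).range, T x = y := fun n => by
      obtain ⟨z, hz⟩ := (hMmem y).1 hy (n + 1)
      refine ⟨(T ^ n) z, ⟨z, rfl⟩, ?_⟩
      rw [← hz, pow_succ']
      rfl
    obtain ⟨x, hx, rfl⟩ := hpre n₀
    refine ⟨⟨x, (hMmem x).2 fun n => ?_⟩, rfl⟩
    rcases le_total n n₀ with hn | hn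
    · exact range_pow_le hn hx
    · obtain ⟨x', hx', hxx⟩ := hpre n
      have h1 : x - x' ∈ T.ker := by
        change T (x - x') = 0
        rw [map_sub, hxx, sub_self]
      have h2 := hstab _ h1 (Submodule.sub_mem _ hx (range_pow_le hn hx')) n
      rw [← sub_add_cancel x x']
      exact Submodule.add_mem _ h2 hx'
  obtain ⟨R, hR⟩ := exists_mul_eq_one_of_surjective hSs
  -- For small μ ≠ 0, S - μ is surjective by stability of right inverses and injective as a
  -- restriction of T - μ. So S is a right-invertible limit of units.
  have hSu : IsUnit S := by
    refine isUnit_of_rightInverse_of_mem_closure hR (mem_closure_isUnit_of_eventually ?_)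
    filter_upwards [hT, (eventually_exists_rightInverse_sub hR).filter_mono nhdsWithin_le_nhds]
      with μ hμ ⟨R', hR'⟩
    have h1 : Function.RightInverse R' (S - μ • (1 : M →L[ℂ] M)) := fun x => congr($hR' x)
    refine isUnit_iff_bijective.2 ⟨fun x y hxy => Subtype.ext ?_, h1.surjective⟩
    exact (isUnit_iff_bijective.1 hμ).1 (congrArg Subtype.val hxy)
  have hle : (T ^ n₀).ker ≤ (T ^ (n₀ + 1)).ker := by
    rw [pow_succ']
    exact LinearMap.ker_le_ker_comp _ _
  -- Infinite ascent produces a nonzero kernel vector of T inside M, against injectivity of S.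
  obtain ⟨x, hx, hx'⟩ := SetLike.exists_of_lt (lt_of_le_of_ne hle (hne n₀))
  have hxk : (T ^ n₀) x ∈ T.ker := by
    rw [pow_succ'] at hx
    exact hx
  have hxM : (T ^ n₀) x ∈ M := (hMmem _).2 (hstab _ hxk ⟨x, rfl⟩)
  have : (⟨(T ^ n₀) x, hxM⟩ : M) = 0 :=
    (isUnit_iff_bijective.1 hSu).1 (Subtype.ext (by rw [hSval, map_zero]; exact hxk))
  exact hx' (congrArg Subtype.val this)

/-- An operator which is invertible up to finite rank and has finite ascent has finite descent. -/
theorem IsUnitAddFiniteRank.descent_lt_top {T : H →L[ℂ] H} (h : T.IsUnitAddFiniteRank)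
    (hT : T.ascent < ⊤) : T.descent < ⊤ := by
  obtain ⟨n, hn⟩ := ascent_lt_top_iff.1 hT
  -- m ≥ 1 is what puts the range of T ^ (m + m) inside that of T ^ (m + 1).
  obtain ⟨m, hm, hm0⟩ : ∃ m : ℕ, (T ^ m).ker = (T ^ (m + 1)).ker ∧ 1 ≤ m :=
    ⟨n + 1, by rw [ker_pow_add_eq hn 1, add_assoc, ker_pow_add_eq hn], by omega⟩
  have := finiteDimensional_ker_pow h.isLeftInvertibleAddFiniteRank.finiteDimensional_ker m
  have hQ : ((T ^ m).ker.starProjection : H →ₗ[ℂ] H).HasFiniteRange :=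
    (LinearMap.HasFiniteRange.of_finite_dom (f := (T ^ m).ker.subtype)).comp_right
      ((T ^ m).ker.orthogonalProjectionOnto : H →ₗ[ℂ] (T ^ m).ker)
  have hu : IsUnit (T ^ m + (T ^ m).ker.starProjection) := by
    refine ((h.pow m).add_finiteRank hQ).isUnit_of_injective
      ((injective_iff_map_eq_zero _).2 fun x hx => ?_)
    have hx' : (T ^ m) x + (T ^ m).ker.starProjection x = 0 := hx
    have hmem := (T ^ m).ker.starProjection_apply_mem x
    have h0 : (T ^ m).ker.starProjection x = 0 := by
      refine Submodule.disjoint_def.1 (disjoint_ker_range_pow hm) _ hmem ⟨-x, ?_⟩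
      exact (map_neg (T ^ m) x).trans (eq_neg_of_add_eq_zero_right hx').symm
    rw [h0, add_zero] at hx'
    rwa [Submodule.starProjection_eq_self_iff.2 hx'] at h0
  refine descent_lt_top_iff.2 ⟨m, le_antisymm ?_ (range_pow_le (Nat.le_succ m))⟩
  rintro _ ⟨y, rfl⟩
  obtain ⟨x, rfl⟩ := (isUnit_iff_bijective.1 hu).2 y
  have h0 : (T ^ m) ((T ^ m).ker.starProjection x) = 0 :=
    (T ^ m).ker.starProjection_apply_mem x
  refine range_pow_le (m := m + 1) (n := m + m) (by omega) ⟨x, ?_⟩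
  change (T ^ (m + m)) x = (T ^ m) ((T ^ m) x + (T ^ m).ker.starProjection x)
  rw [map_add, h0, add_zero, pow_add]
  rfl

/-- The Riesz projection of a Browder operator. -/
theorem IsBrowder.exists_projection {T : H →L[ℂ] H} (h : T.IsBrowder) :
    ∃ (P : H →L[ℂ] H) (n : ℕ), (P : H →ₗ[ℂ] H).HasFiniteRange ∧ P * P = P ∧ Commute T P ∧
      T ^ (n + 1) * P = 0 ∧ IsUnit (T ^ (n + 1) + P) := by
  obtain ⟨hF, ha, hd⟩ := h
  obtain ⟨a, ha⟩ := ascent_lt_top_iff.1 ha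
  obtain ⟨d, hd⟩ := descent_lt_top_iff.1 hd
  obtain ⟨n, hn⟩ : ∃ n, n = a + d := ⟨_, rfl⟩
  have hker : (T ^ (n + 1)).ker = (T ^ (n + 1 + 1)).ker := by
    rw [hn, show a + d + 1 + 1 = a + (d + 1 + 1) by ring, add_assoc, ker_pow_add_eq ha,
      ker_pow_add_eq ha]
  have hran : (T ^ (n + 1)).range = (T ^ (n + 1 + (n + 1))).range := by
    rw [show n + 1 + (n + 1) = d + (n + 1 + (a + 1)) by omega, range_pow_add_eq hd,
      show n + 1 = d + (a + 1) by omega, range_pow_add_eq hd]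
  set W := T ^ (n + 1) with hW
  have hTW : Commute T W := (Commute.refl T).pow_right _
  have hdisj : Disjoint W.ker W.range := disjoint_ker_range_pow hker
  have : FiniteDimensional ℂ W.ker := finiteDimensional_ker_pow hF.finite_ker _
  set Q := W.ker.starProjection with hQdef
  have hQ : (Q : H →ₗ[ℂ] H).HasFiniteRange :=
    (LinearMap.HasFiniteRange.of_finite_dom (f := W.ker.subtype)).comp_right
      (W.ker.orthogonalProjectionOnto : H →ₗ[ℂ] W.ker)
  have hWQ : ∀ x, W (Q x) = 0 := fun x => W.ker.starProjection_apply_mem x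
  have hQW : ∀ x, W x = 0 → Q x = x := fun x hx => Submodule.starProjection_eq_self_iff.2 hx
  have hdec : ∀ y, ∃ x z, W z = 0 ∧ y = W x + z := fun y => by
    have : W y ∈ (T ^ (n + 1 + (n + 1))).range := hran ▸ ⟨y, rfl⟩
    obtain ⟨x, hx⟩ := this
    have hx' : W (W x) = W y := by
      rw [← hx, pow_add]
      rfl
    exact ⟨x, y - W x, by rw [map_sub, hx', sub_self], by abel⟩
  have hu : IsUnit (W + Q) := by
    refine isUnit_iff_bijective.2 ⟨(injective_iff_map_eq_zero _).2 fun x hx => ?_, fun y => ?_⟩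
    · have hx' : W x + Q x = 0 := hx
      have h0 : Q x = 0 := by
        refine Submodule.disjoint_def.1 hdisj _ (hWQ x) ⟨-x, ?_⟩
        exact (map_neg W x).trans (eq_neg_of_add_eq_zero_right hx').symm
      rw [h0, add_zero] at hx'
      rwa [hQW x hx'] at h0
    · obtain ⟨x, z, hz, rfl⟩ := hdec y
      refine ⟨x - Q x + z, ?_⟩
      change W (x - Q x + z) + Q (x - Q x + z) = W x + z
      rw [map_add, map_add, map_sub, map_sub, hWQ, hz, hQW z hz, hQW (Q x) (hWQ x)]
      abel
  obtain ⟨u, hu⟩ := hu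
  have huinv : ∀ x, (↑u⁻¹ : H →L[ℂ] H) (W x + Q x) = x := fun x => by
    have := congr($(u.inv_mul) x)
    rw [hu] at this
    exact this
  -- This is the projection onto ker W along ran W: u fixes ker W, and u⁻¹ sends Wx to x - Qx, which
  -- Q kills. Boundedness comes for free.
  set P : H →L[ℂ] H := Q * ↑u⁻¹ with hP
  have hPz : ∀ z, W z = 0 → P z = z := fun z hz => by
    have := huinv z
    rw [hz, hQW z hz, zero_add] at this
    change Q ((↑u⁻¹ : H →L[ℂ] H) z) = z
    rw [this, hQW z hz]
  have hPW : ∀ x, P (W x) = 0 := fun x => by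
    have := huinv (x - Q x)
    rw [map_sub, map_sub, hWQ, hQW (Q x) (hWQ x), sub_self, sub_zero, add_zero] at this
    change Q ((↑u⁻¹ : H →L[ℂ] H) (W x)) = 0
    rw [this, map_sub, hQW (Q x) (hWQ x), sub_self]
  have hWP : ∀ x, W (P x) = 0 := fun x => hWQ _
  have hWT : ∀ x, W (T x) = T (W x) := fun x => congr($(hTW.eq.symm) x)
  refine ⟨P, n, hasFiniteRange_mul_right _ hQ, ext fun x => hPz _ (hWP x), ext fun y => ?_,
    ext fun x => hWP x, isUnit_iff_bijective.2 ⟨(injective_iff_map_eq_zero _).2 fun x hx => ?_,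
      fun y => ?_⟩⟩
  · obtain ⟨x, z, hz, rfl⟩ := hdec y
    change T (P (W x + z)) = P (T (W x + z))
    rw [map_add, map_add, map_add, map_add, hPW, hPz z hz, map_zero, ← hWT, hPW,
      hPz (T z) (by rw [hWT, hz, map_zero])]
  · have hx' : W x + P x = 0 := hx
    have h1 := congrArg P hx'
    rw [map_add, hPW, zero_add, map_zero, hPz (P x) (hWP x)] at h1
    rw [h1, add_zero] at hx'
    rwa [hPz x hx'] at h1
  · obtain ⟨x, z, hz, rfl⟩ := hdec y
    refine ⟨x - P x + z, ?_⟩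
    change W (x - P x + z) + P (x - P x + z) = W x + z
    rw [map_add, map_add, map_sub, map_sub, hWP, hz, hPz z hz, hPz (P x) (hWP x)]
    abel

theorem IsBrowder.isPuncturedInvertible {T : H →L[ℂ] H} (h : T.IsBrowder) :
    T.IsPuncturedInvertible := by
  obtain ⟨P, n, -, hP, hc, hn, hu⟩ := h.exists_projection
  exact eventually_isUnit_sub_of_idempotent hP hc hn hu

theorem IsBrowder.isUnitAddFiniteRank {T : H →L[ℂ] H} (h : T.IsBrowder) :
    T.IsUnitAddFiniteRank := by
  obtain ⟨P, n, hfin, hP, hc, hn, hu⟩ := h.exists_projection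
  exact ⟨T + P, -P, isUnit_add_idempotent hP hc hn hu, hasFiniteRange_neg hfin, by abel⟩

/-- An operator is Browder if and only if it is upper semi-Weyl and `0` is not an accumulation
point of its spectrum. -/
theorem isBrowder_iff {T : H →L[ℂ] H} :
    T.IsBrowder ↔ T.IsUpperSemiWeyl ∧ T.IsPuncturedInvertible := by
  constructor
  · intro h
    exact ⟨isUpperSemiWeyl_iff_isLeftInvertibleAddFiniteRank.2
      h.isUnitAddFiniteRank.isLeftInvertibleAddFiniteRank, h.isPuncturedInvertible⟩
  · rintro ⟨h, hT⟩
    have hu := h.isLeftInvertibleAddFiniteRank.isUnitAddFiniteRank hT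
    have ha := hu.ascent_lt_top hT
    exact ⟨hu.isFredholm, ha, hu.descent_lt_top ha⟩

/-- The isolation of `0` in the spectrum is preserved by commuting finite rank perturbations. -/
theorem IsPuncturedInvertible.add_finiteRank {T K : H →L[ℂ] H} (h : T.IsPuncturedInvertible)
    (hK : (K : H →ₗ[ℂ] H).HasFiniteRange) (hKT : Commute K T) :
    (T + K).IsPuncturedInvertible := by
  have : FiniteDimensional ℂ (K : H →ₗ[ℂ] H).range := Module.Finite.iff_fg.2 hK
  have hcomm : ∀ x, K (T x) = T (K x) := fun x => congr($(hKT.eq) x)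
  have hmaps : ∀ x ∈ (K : H →ₗ[ℂ] H).range,
      ((T + K : H →L[ℂ] H) : H →ₗ[ℂ] H) x ∈ (K : H →ₗ[ℂ] H).range := by
    rintro _ ⟨x, rfl⟩
    refine ⟨T x + K x, ?_⟩
    change K (T x + K x) = T (K x) + K (K x)
    rw [map_add, hcomm]
  -- If (T + K)x = μx with x ≠ 0 and T - μ invertible, then Kx is an eigenvector of f for μ. Only
  -- finitely many μ qualify.
  let f : Module.End ℂ (K : H →ₗ[ℂ] H).range := ((T + K : H →L[ℂ] H) : H →ₗ[ℂ] H).restrict hmaps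
  filter_upwards [h, f.finite_hasEigenvalue.eventually_cofinite_notMem.filter_mono
    (nhdsNE_le_cofinite 0)] with μ hμ hf
  refine IsUnitAddFiniteRank.isUnit_of_injective ⟨T - μ • 1, K, hμ, hK, by abel⟩
    ((injective_iff_map_eq_zero _).2 fun x hx => ?_)
  have hx' : T x + K x - μ • x = 0 := hx
  by_contra hx0
  refine hf (Module.End.hasEigenvalue_of_hasEigenvector (x := ⟨K x, ⟨x, rfl⟩⟩)
    ⟨Module.End.mem_eigenspace_iff.2 (Subtype.ext ?_), fun hK0 => hx0 ?_⟩)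
  · change T (K x) + K (K x) = μ • K x
    rw [← hcomm, ← map_add, sub_eq_zero.1 hx', map_smul]
  · have hKx : K x = 0 := congrArg Subtype.val hK0
    refine (injective_iff_map_eq_zero _).1 (isUnit_iff_bijective.1 hμ).1 x ?_
    change T x - μ • x = 0
    rw [← hx', hKx, add_zero]

end ContinuousLinearMap

/-! ### Pointwise descriptions of the spectra. -/

theorem Complex.eventually_nhdsNE_iff {p : ℂ → Prop} {z : ℂ} :
    (∀ᶠ w in 𝓝[≠] z, p w) ↔ ∃ ε : ℝ, 0 < ε ∧ ∀ w, 0 < ‖z - w‖ → ‖z - w‖ < ε → p w := by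
  rw [eventually_nhdsWithin_iff, Metric.eventually_nhds_iff]
  simp only [dist_eq_norm_sub', Set.mem_compl_iff, Set.mem_singleton_iff, norm_pos_iff, sub_ne_zero,
    gt_iff_lt]
  exact exists_congr fun ε => and_congr_right fun _ =>
    ⟨fun h w h1 h2 => h h2 h1.symm, fun h w h1 h2 => h w (Ne.symm h2) h1⟩

namespace ContinuousLinearMap

variable {H : Type*} [NormedAddCommGroup H] [InnerProductSpace ℂ H]

theorem isPuncturedInvertible_sub_iff {T : H →L[ℂ] H} {z : ℂ} :
    (T - z • (1 : H →L[ℂ] H)).IsPuncturedInvertible ↔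
      ∀ᶠ w in 𝓝[≠] z, IsUnit (T - w • (1 : H →L[ℂ] H)) := by
  rw [IsPuncturedInvertible, Complex.eventually_nhdsNE_iff, Complex.eventually_nhdsNE_iff]
  refine exists_congr fun ε => and_congr_right fun _ => ⟨fun h w h1 h2 => ?_, fun h w h1 h2 => ?_⟩
  · have := h (w - z) (by rwa [zero_sub, neg_sub]) (by rwa [zero_sub, neg_sub])
    rwa [sub_smul, sub_sub, add_sub_cancel] at this
  · have := h (z + w) (by simpa using h1) (by simpa using h2)
    rwa [add_smul, ← sub_sub] at this

theorem mem_spectrum_iff {T : H →L[ℂ] H} {z : ℂ} :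
    z ∈ spectrum ℂ T ↔ ¬ IsUnit (T - z • (1 : H →L[ℂ] H)) := by
  rw [spectrum.mem_iff, Algebra.algebraMap_eq_smul_one, ← IsUnit.neg_iff, neg_sub]

theorem mem_isoSpectrum_iff {T : H →L[ℂ] H} {z : ℂ} :
    z ∈ T.isoSpectrum ↔ ¬ IsUnit (T - z • (1 : H →L[ℂ] H)) ∧
      (T - z • (1 : H →L[ℂ] H)).IsPuncturedInvertible := by
  rw [isPuncturedInvertible_sub_iff, Complex.eventually_nhdsNE_iff, ← mem_spectrum_iff]
  refine and_congr_right fun hz => exists_congr fun ε => and_congr_right fun hε =>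
    ⟨fun h w h1 h2 => ?_, fun h => ?_⟩
  · by_contra hw
    have : w ∈ ({z} : Set ℂ) :=
      h ▸ ⟨by rwa [Metric.mem_ball, dist_eq_norm_sub'], mem_spectrum_iff.2 hw⟩
    rw [Set.mem_singleton_iff.1 this, sub_self, norm_zero] at h1
    exact lt_irrefl _ h1
  · refine Set.Subset.antisymm (fun w hw => ?_)
      (Set.singleton_subset_iff.2 ⟨Metric.mem_ball_self hε, hz⟩)
    by_contra hne
    refine mem_spectrum_iff.1 hw.2 (h w (norm_pos_iff.2 (sub_ne_zero.2 (Ne.symm hne))) ?_)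
    rw [← dist_eq_norm_sub']
    exact hw.1

theorem mem_rhoVV_iff {T : H →L[ℂ] H} {z : ℂ} :
    z ∈ T.rhoVV ↔ ∀ᶠ w in 𝓝[≠] z, (T - w • (1 : H →L[ℂ] H)).IsUpperSemiWeyl ∧
      ∀ n : ℕ, 1 ≤ n →
        (T - w • (1 : H →L[ℂ] H)).ker ≤ ((T - w • (1 : H →L[ℂ] H)) ^ n).range := by
  rw [Complex.eventually_nhdsNE_iff]
  simp only [rhoVV, Set.mem_ofPred_eq, le_iInf_iff]

theorem hasEigenvalue_iff {T : H →L[ℂ] H} {z : ℂ} :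
    Module.End.HasEigenvalue (T : Module.End ℂ H) z ↔ (T - z • (1 : H →L[ℂ] H)).ker ≠ ⊥ := by
  rw [Module.End.hasEigenvalue_iff, Module.End.eigenspace_def]
  rfl

/-- `T` is consistently invertible if and only if left and right invertibility of `T` are
equivalent. -/
theorem isConsistentlyInvertible_iff {T : H →L[ℂ] H} :
    T.IsConsistentlyInvertible ↔
      ((∃ L : H →L[ℂ] H, L * T = 1) ↔ ∃ R : H →L[ℂ] H, T * R = 1) := by
  constructor
  · refine fun h => ⟨fun ⟨L, hL⟩ => ?_, fun ⟨R, hR⟩ => ?_⟩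
    · obtain ⟨u, hu⟩ := (h L).2 (hL ▸ isUnit_one)
      exact ⟨L * ↑u⁻¹, by rw [← mul_assoc, ← hu, u.mul_inv]⟩
    · obtain ⟨u, hu⟩ := (h R).1 (hR ▸ isUnit_one)
      exact ⟨↑u⁻¹ * R, by rw [mul_assoc, ← hu, u.inv_mul]⟩
  · intro h S
    have hunit : (∃ L : H →L[ℂ] H, L * T = 1) → (∃ R : H →L[ℂ] H, T * R = 1) → IsUnit T :=
      fun ⟨L, hL⟩ ⟨R, hR⟩ => isUnit_iff_exists.2 ⟨R, hR, left_inv_eq_right_inv hL hR ▸ hL⟩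
    constructor
    · rintro ⟨u, hu⟩
      have hR : ∃ R : H →L[ℂ] H, T * R = 1 := ⟨S * ↑u⁻¹, by rw [← mul_assoc, ← hu, u.mul_inv]⟩
      obtain ⟨v, rfl⟩ := hunit (h.2 hR) hR
      exact ((Units.isUnit_units_mul v S).1 ⟨u, hu⟩).mul v.isUnit
    · rintro ⟨u, hu⟩
      have hL : ∃ L : H →L[ℂ] H, L * T = 1 := ⟨↑u⁻¹ * S, by rw [mul_assoc, ← hu, u.inv_mul]⟩
      obtain ⟨v, rfl⟩ := hunit hL (h.1 hL)
      exact v.isUnit.mul ((Units.isUnit_mul_units S v).1 ⟨u, hu⟩)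

theorem ker_eq_bot_of_isBoundedBelow {T : H →L[ℂ] H} (h : T.IsBoundedBelow) : T.ker = ⊥ := by
  obtain ⟨c, hc, h⟩ := h
  refine LinearMap.ker_eq_bot'.2 fun x hx => norm_le_zero_iff.1 ?_
  have hx' : T x = 0 := hx
  have := h x
  rw [hx', norm_zero] at this
  exact nonpos_of_mul_nonpos_right this hc

theorem isConsistentlyInvertible_of_isUnit {T : H →L[ℂ] H} (h : IsUnit T) :
    T.IsConsistentlyInvertible := by
  obtain ⟨u, rfl⟩ := h
  exact isConsistentlyInvertible_iff.2
    ⟨fun _ => ⟨↑u⁻¹, u.mul_inv⟩, fun _ => ⟨↑u⁻¹, u.inv_mul⟩⟩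

theorem isIsoloid_iff {T : H →L[ℂ] H} :
    T.IsIsoloid ↔ ∀ z : ℂ, (T - z • (1 : H →L[ℂ] H)).IsPuncturedInvertible →
      IsUnit (T - z • (1 : H →L[ℂ] H)) ∨ (T - z • (1 : H →L[ℂ] H)).ker ≠ ⊥ := by
  rw [IsIsoloid]
  refine forall_congr' fun z => ?_
  rw [mem_isoSpectrum_iff, hasEigenvalue_iff]
  tauto

variable [CompleteSpace H]

theorem isBoundedBelow_of_isUnit {T : H →L[ℂ] H} (h : IsUnit T) : T.IsBoundedBelow := by
  obtain ⟨u, rfl⟩ := h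
  exact isBoundedBelow_iff_exists_leftInverse.2 ⟨↑u⁻¹, u.inv_mul⟩

theorem IsBoundedBelow.isUpperSemiWeyl {T : H →L[ℂ] H} (h : T.IsBoundedBelow) :
    T.IsUpperSemiWeyl := by
  obtain ⟨L, hL⟩ := isBoundedBelow_iff_exists_leftInverse.1 h
  exact isUpperSemiWeyl_iff_isLeftInvertibleAddFiniteRank.2
    ⟨T, 0, L, hL, LinearMap.HasFiniteRange.zero, (add_zero T).symm⟩

/-- T is a limit of units, so a one-sided inverse would already make it invertible. -/
theorem IsPuncturedInvertible.isConsistentlyInvertible {T : H →L[ℂ] H}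
    (hT : T.IsPuncturedInvertible) : T.IsConsistentlyInvertible := by
  have hcl := mem_closure_isUnit_of_eventually hT
  by_cases h : IsUnit T
  · exact isConsistentlyInvertible_of_isUnit h
  · exact isConsistentlyInvertible_iff.2
      ⟨fun ⟨L, hL⟩ => absurd (isUnit_of_leftInverse_of_mem_closure hL hcl) h,
        fun ⟨R, hR⟩ => absurd (isUnit_of_rightInverse_of_mem_closure hR hcl) h⟩

theorem IsUpperSemiWeyl.isUnit_of_ker_eq_bot {T : H →L[ℂ] H} (h : T.IsUpperSemiWeyl)
    (hT : T.IsPuncturedInvertible) (hker : T.ker = ⊥) : IsUnit T :=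
  (h.isLeftInvertibleAddFiniteRank.isUnitAddFiniteRank hT).isUnit_of_injective
    (LinearMap.ker_eq_bot.1 hker)

theorem notMem_closure_consistentInvertibilitySpectrum {T : H →L[ℂ] H} {z : ℂ}
    (h : (T - z • (1 : H →L[ℂ] H)).IsPuncturedInvertible) :
    z ∉ closure T.consistentInvertibilitySpectrum := by
  rw [mem_closure_iff_frequently, not_frequently]
  have h1 := eventually_nhdsWithin_iff.1 (isPuncturedInvertible_sub_iff.1 h)
  filter_upwards [h1] with w hw
  rw [consistentInvertibilitySpectrum, Set.mem_ofPred_eq, not_not]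
  rcases eq_or_ne w z with rfl | hne
  · exact h.isConsistentlyInvertible
  · exact isConsistentlyInvertible_of_isUnit (hw hne)

theorem mem_rhoVV_of_eventually_isBoundedBelow {T : H →L[ℂ] H} {z : ℂ}
    (h : ∀ᶠ w in 𝓝[≠] z, (T - w • (1 : H →L[ℂ] H)).IsBoundedBelow) : z ∈ T.rhoVV := by
  refine mem_rhoVV_iff.2 (h.mono fun w hw => ⟨hw.isUpperSemiWeyl, fun n _ => ?_⟩)
  rw [ker_eq_bot_of_isBoundedBelow hw]
  exact bot_le

theorem mem_rhoVV_of_isPuncturedInvertible {T : H →L[ℂ] H} {z : ℂ}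
    (h : (T - z • (1 : H →L[ℂ] H)).IsPuncturedInvertible) : z ∈ T.rhoVV :=
  mem_rhoVV_of_eventually_isBoundedBelow
    ((isPuncturedInvertible_sub_iff.1 h).mono fun _ hw => isBoundedBelow_of_isUnit hw)

theorem mem_rhoVV_of_isBoundedBelow {T : H →L[ℂ] H} {z : ℂ}
    (h : (T - z • (1 : H →L[ℂ] H)).IsBoundedBelow) : z ∈ T.rhoVV := by
  obtain ⟨L, hL⟩ := isBoundedBelow_iff_exists_leftInverse.1 h
  refine mem_rhoVV_of_eventually_isBoundedBelow (Eventually.filter_mono nhdsWithin_le_nhds ?_)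
  have h1 : Tendsto (fun w : ℂ => w - z) (𝓝 z) (𝓝 0) := by
    simpa using (continuous_id.sub continuous_const).tendsto (x := z) (f := fun w : ℂ => w - z)
  filter_upwards [h1.eventually (eventually_exists_leftInverse_sub hL)] with w hw
  rw [sub_smul, sub_sub, add_sub_cancel] at hw
  exact isBoundedBelow_iff_exists_leftInverse.2 hw

/-- Pointwise form of property `(UW_E)`. -/
theorem propertyUWE_iff {T : H →L[ℂ] H} :
    T.PropertyUWE ↔ ∀ z : ℂ, (T - z • (1 : H →L[ℂ] H)).IsUpperSemiWeyl ↔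
      (T - z • (1 : H →L[ℂ] H)).IsBoundedBelow ∨
        ((T - z • (1 : H →L[ℂ] H)).IsPuncturedInvertible ∧ (T - z • (1 : H →L[ℂ] H)).ker ≠ ⊥) := by
  rw [PropertyUWE, Set.ext_iff]
  refine forall_congr' fun z => ?_
  have hker : IsUnit (T - z • (1 : H →L[ℂ] H)) → (T - z • (1 : H →L[ℂ] H)).ker = ⊥ := fun h =>
    ker_eq_bot_of_isBoundedBelow (isBoundedBelow_of_isUnit h)
  simp only [Set.mem_sdiff, approxPointSpectrum, isolatedEigenvalues, upperSemiWeylSpectrum,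
    Set.mem_ofPred_eq, mem_isoSpectrum_iff, nullity_pos_iff]
  tauto

/-- Under property `(UW_E)`, a point of `ρ_vv(T)` which is not in the closure of `σ_CI(T)` is not
an accumulation point of the spectrum. -/
theorem PropertyUWE.isPuncturedInvertible {T : H →L[ℂ] H} (hT : T.PropertyUWE) {z : ℂ}
    (hz : z ∈ T.rhoVV) (hCI : z ∉ closure T.consistentInvertibilitySpectrum) :
    (T - z • (1 : H →L[ℂ] H)).IsPuncturedInvertible := by
  rw [mem_closure_iff_frequently, not_frequently] at hCI
  rw [isPuncturedInvertible_sub_iff]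
  filter_upwards [mem_rhoVV_iff.1 hz, hCI.filter_mono nhdsWithin_le_nhds] with w ⟨hw, hker⟩ hCIw
  have hbb : (T - w • (1 : H →L[ℂ] H)).IsBoundedBelow := by
    refine (((propertyUWE_iff.1 hT) w).1 hw).resolve_right fun ⟨hp, hne⟩ => hne ?_
    obtain ⟨-, ha, -⟩ := isBrowder_iff.2 ⟨hw, hp⟩
    obtain ⟨n, hn⟩ := ascent_lt_top_iff.1 ha
    -- The exponent n + 1 rather than n ensures that the power's kernel contains that of T - w, even
    -- if n = 0.
    have hn1 : ((T - w • (1 : H →L[ℂ] H)) ^ (n + 1)).ker =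
        ((T - w • (1 : H →L[ℂ] H)) ^ (n + 1 + 1)).ker := by
      rw [ker_pow_add_eq hn 1, add_assoc, ker_pow_add_eq hn]
    refine eq_bot_iff.2 (disjoint_ker_range_pow hn1 ?_ (hker _ (by omega)))
    rw [pow_succ]
    exact LinearMap.ker_le_ker_comp _ _
  rw [consistentInvertibilitySpectrum, Set.mem_ofPred_eq, not_not,
    isConsistentlyInvertible_iff] at hCIw
  obtain ⟨L, hL⟩ := isBoundedBelow_iff_exists_leftInverse.1 hbb
  obtain ⟨R, hR⟩ := hCIw.1 ⟨L, hL⟩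
  exact isUnit_iff_exists.2 ⟨R, hR, left_inv_eq_right_inv hL hR ▸ hL⟩

end ContinuousLinearMap

/-! ### The equivalence. -/

open ContinuousLinearMap in
theorem theorem2p2 {H : Type*} [NormedAddCommGroup H] [InnerProductSpace ℂ H] [CompleteSpace H]
    [TopologicalSpace.SeparableSpace H] (hH : ¬ FiniteDimensional ℂ H)
    (T K : H →L[ℂ] H) (hT : T.PropertyUWE)
    (hK : FiniteDimensional ℂ K.range) (hKT : Commute K T) :
    List.TFAE [
      (T + K).IsIsoloid ∧ (T + K).PropertyUWE,
      T.IsIsoloid ∧ (T + K).PropertyUWE,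
      T.browderSpectrum ∩ (T + K).approxPointSpectrum =
        T.sigmaVV ∪ (closure T.consistentInvertibilitySpectrum ∩ T.approxPointSpectrum)] := by
  have hKf : (K : H →ₗ[ℂ] H).HasFiniteRange := Module.Finite.iff_fg.1 hK
  have hsub : ∀ z : ℂ, T + K - z • (1 : H →L[ℂ] H) = (T - z • (1 : H →L[ℂ] H)) + K := fun z => by
    abel
  have hsub' : ∀ z : ℂ, T - z • (1 : H →L[ℂ] H) = (T + K - z • (1 : H →L[ℂ] H)) + -K := fun z => by
    abel
  have hcomm : ∀ z : ℂ, Commute K (T - z • (1 : H →L[ℂ] H)) := fun z =>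
    hKT.sub_right ((Commute.one_right K).smul_right z)
  have hweyl : ∀ z : ℂ, (T + K - z • (1 : H →L[ℂ] H)).IsUpperSemiWeyl ↔
      (T - z • (1 : H →L[ℂ] H)).IsUpperSemiWeyl := fun z =>
    ⟨fun h => hsub' z ▸ h.add_finiteRank (hasFiniteRange_neg hKf),
      fun h => hsub z ▸ h.add_finiteRank hKf⟩
  have hpunct : ∀ z : ℂ, (T + K - z • (1 : H →L[ℂ] H)).IsPuncturedInvertible ↔
      (T - z • (1 : H →L[ℂ] H)).IsPuncturedInvertible := fun z =>
    ⟨fun h => hsub' z ▸ h.add_finiteRank (hasFiniteRange_neg hKf)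
        (hsub z ▸ ((hcomm z).add_right (Commute.refl K)).neg_left),
      fun h => hsub z ▸ h.add_finiteRank hKf (hcomm z)⟩
  have hclosed : T.browderSpectrum ∩ (T + K).approxPointSpectrum =
        T.sigmaVV ∪ (closure T.consistentInvertibilitySpectrum ∩ T.approxPointSpectrum) ↔
      ∀ z : ℂ, (¬ ((T - z • (1 : H →L[ℂ] H)).IsUpperSemiWeyl ∧
          (T - z • (1 : H →L[ℂ] H)).IsPuncturedInvertible) ∧
            ¬ (T + K - z • (1 : H →L[ℂ] H)).IsBoundedBelow) ↔
        (z ∉ T.rhoVV ∨ (z ∈ closure T.consistentInvertibilitySpectrum ∧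
          ¬ (T - z • (1 : H →L[ℂ] H)).IsBoundedBelow)) := by
    rw [Set.ext_iff]
    simp only [browderSpectrum, approxPointSpectrum, sigmaVV, Set.mem_inter_iff, Set.mem_union,
      Set.mem_compl_iff, Set.mem_ofPred_eq, isBrowder_iff]
  have hrho := fun z (h : z ∈ T.rhoVV) (h' : z ∉ closure T.consistentInvertibilitySpectrum) =>
    hT.isPuncturedInvertible h h'
  rw [propertyUWE_iff] at hT
  rw [hclosed]
  simp only [isIsoloid_iff, propertyUWE_iff, hweyl, hpunct]
  have hUB : ∀ S : H →L[ℂ] H, IsUnit S → S.IsBoundedBelow := fun S h => isBoundedBelow_of_isUnit h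
  have hBW : ∀ S : H →L[ℂ] H, S.IsBoundedBelow → S.IsUpperSemiWeyl := fun S h => h.isUpperSemiWeyl
  have hWU : ∀ S : H →L[ℂ] H, S.IsPuncturedInvertible → S.IsUpperSemiWeyl → IsUnit S ∨ S.ker ≠ ⊥ :=
    fun S h1 h2 => or_iff_not_imp_right.2 fun h3 => h2.isUnit_of_ker_eq_bot h1 (not_not.1 h3)
  have hBK : ∀ S : H →L[ℂ] H, S.IsBoundedBelow → S.ker = ⊥ :=
    fun S h => ker_eq_bot_of_isBoundedBelow h
  have hPrho : ∀ z : ℂ, (T - z • (1 : H →L[ℂ] H)).IsPuncturedInvertible → z ∈ T.rhoVV :=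
    fun z h => mem_rhoVV_of_isPuncturedInvertible h
  have hBrho : ∀ z : ℂ, (T - z • (1 : H →L[ℂ] H)).IsBoundedBelow → z ∈ T.rhoVV :=
    fun z h => mem_rhoVV_of_isBoundedBelow h
  have hPC : ∀ z : ℂ, (T - z • (1 : H →L[ℂ] H)).IsPuncturedInvertible →
      z ∉ closure T.consistentInvertibilitySpectrum :=
    fun z h => notMem_closure_consistentInvertibilitySpectrum h
  have hW' : ∀ z : ℂ, (T + K - z • (1 : H →L[ℂ] H)).IsPuncturedInvertible →
      (T - z • (1 : H →L[ℂ] H)).IsUpperSemiWeyl →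
      IsUnit (T + K - z • (1 : H →L[ℂ] H)) ∨ (T + K - z • (1 : H →L[ℂ] H)).ker ≠ ⊥ :=
    fun z h1 h2 => hWU _ h1 ((hweyl z).2 h2)
  have hB' : ∀ z : ℂ, (T + K - z • (1 : H →L[ℂ] H)).IsBoundedBelow →
      (T - z • (1 : H →L[ℂ] H)).IsUpperSemiWeyl := fun z h => (hweyl z).1 (hBW _ h)
  tfae_have 1 → 2 := by
    rintro ⟨hiso, huwe⟩
    refine ⟨fun z hz => ?_, huwe⟩
    have := hiso z hz
    have := huwe z
    have := hWU _ hz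
    have := hUB (T + K - z • (1 : H →L[ℂ] H))
    tauto
  tfae_have 2 → 1 := by
    rintro ⟨hiso, huwe⟩
    refine ⟨fun z hz => ?_, huwe⟩
    have := hiso z hz
    have := hT z
    have := hW' z ((hpunct z).2 hz)
    have := hUB (T - z • (1 : H →L[ℂ] H))
    tauto
  -- P gives W, by isoloidness and (UW_E) for T. B gives W, hence B' or P, by (UW_E) for T + K; B'
  -- gives W, hence B or P, by (UW_E) for T.
  tfae_have 2 → 3 := by
    rintro ⟨hiso, huwe⟩ z
    have h1 := hiso z
    have h2 := huwe z
    have h3 := hT z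
    have h4 := hrho z
    have h5 := hPrho z
    have h6 := hBrho z
    have h7 := hPC z
    have h8 := hUB (T - z • (1 : H →L[ℂ] H))
    grind
  -- Condition 3 turns P into W, since B' also implies W; this yields isoloidness. It turns W, which
  -- gives B or P, into B' or (W and P), whence (UW_E) for T + K.
  tfae_have 3 → 2 := by
    intro h
    refine ⟨fun z hz => ?_, fun z => ?_⟩
    · have h1 := h z
      have h2 := hT z
      have h3 := hB' z
      have h4 := hWU _ hz
      have h5 := hPrho z
      have h7 := hPC z
      grind
    · have h1 := h z
      have h2 := hT z
      have h3 := hB' z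
      have h4 := hW' z
      have h5 := hPrho z
      have h6 := hBrho z
      have h7 := hPC z
      have h8 := hUB (T + K - z • (1 : H →L[ℂ] H))
      have h9 := hBK (T + K - z • (1 : H →L[ℂ] H))
      have h10 := hpunct z
      grind
  tfae_finish
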